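/- A graph is a finite vertex set together with a finite multiset of edges between distinct vertices (parallel edges allowed, no loops). For a graph $G$, write $\kappa(G)$ for its vertex-connectivity (the smallest size of a proper subset $S\subsetneq V(G)$ whose removal leaves a graph with at least two connected components or the one-vertex graph), $\lambda(G)$ for its edge-connectivity (the smallest size of a multiset of edges whose removal leaves a disconnected graph or the one-vertex graph), $\delta(G)$ for its minimum valence (counting edges with multiplicity), and $G\square H$ for the Cartesian product. The gonality $\mathrm{gon}(G)$ is the minimum degree of a divisor $D\in\mathbb{Z}^{V(G)}$ of positive rank, where divisors are equivalent if they differ by a sequence of chip-firing moves, and $r(D)=-1$ if $D$ is not equivalent to an effective divisor and otherwise $r(D)$ is the maximum integer $r$ such that $D-E$ is equivalent to an effective divisor for every effective $E$ of degree $r$. A scramble on $G$ is a collection of nonempty connected vertex subsets (eggs); its order is the maximum integer $k$ such that no set of fewer than $k$ vertices meets every egg, and $|E(A,A^c)|\ge k$ for every $A\subseteq V(G)$ such that some egg is contained in $A$ and some egg is contained in $A^c$. The scramble number $\mathrm{sn}(G)$ is the maximum order of a scramble on $G$. **Theorem.** Let $G$ and $H$ be connected graphs with $\kappa(G)\geq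 2$. (i) If $\lambda(H)\neq 0$ (that is, $H$ has at least two vertices), $\mathrm{gon}(G)=2$, $\frac{|V(H)|}{\lambda(H)}\leq \frac12|V(G)|$, and $|V(H)|\leq \frac12|V(G)|\,\lambda(H)+\big(\delta(G)-\lambda(H)\big)$, then $$\mathrm{sn}(G\square H)=\mathrm{gon}(G\square H)=2|V(H)|.$$ (ii) If $\lambda(H)=\mathrm{gon}(H)$, $\frac{2|V(H)|}{\lambda(H)}\geq |V(G)|$, and $\lambda(H)\leq\delta(G)$, then $$\mathrm{sn}(G\square H)=\mathrm{gon}(G\square H)=|V(G)|\,\lambda(H).$$ -/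

import Mathlib

/-- A finite loopless multigraph on the vertex type `V`: a finite multiset of unordered pairs of
distinct vertices. (Finiteness of the vertex set is the instance `Fintype V` where it is used.) -/
@[ext] structure Multigraph (V : Type*) where
  /-- The multiset of edges. -/
  edges : Multiset (Sym2 V)
  loopless : ∀ e ∈ edges, ¬ e.IsDiag

namespace Multigraph

noncomputable section

variable {V W : Type*}

/-- The underlying simple graph: two vertices are adjacent when at least one edge joins them.
Connectedness does not depend on multiplicities and is read off here. -/
def toSimple (G : Multigraph V) : SimpleGraph V where
  Adj u v := s(u, v) ∈ G.edges
  symm := ⟨fun u v h => by rwa [Sym2.eq_swap]⟩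
  loopless := ⟨fun u h => G.loopless _ h (by simp)⟩

/-- A graph is connected if it is nonempty and any two vertices are joined by a path. -/
def Connected (G : Multigraph V) : Prop := G.toSimple.Connected

/-- A connected (in particular nonempty) subset of the vertices: its induced subgraph is
connected. -/
def ConnectedSet (G : Multigraph V) (S : Set V) : Prop := (G.toSimple.induce S).Connected

open Classical in
/-- The number of edges joining `u` and `v`. -/
def mult (G : Multigraph V) (u v : V) : ℕ := G.edges.count s(u, v)

open Classical in
/-- The valence of `v`: the number of edges incident to `v`, counted with multiplicity. -/
def val (G : Multigraph V) (v : V) : ℕ := (G.edges.filter (fun e => v ∈ e)).card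

/-- The minimum valence `δ(G)`. -/
def minVal (G : Multigraph V) : ℕ := sInf (Set.range G.val)

open Classical in
/-- The number `|E(A, Aᶜ)|` of edges with one vertex in `A` and the other one outside `A`. -/
def cutSize (G : Multigraph V) (A : Set V) : ℕ :=
  (G.edges.filter (fun e => ∃ x ∈ A, ∃ y ∉ A, e = s(x, y))).card

open Classical in
/-- The graph obtained by deleting a multiset `D` of edges. -/
def deleteEdges (G : Multigraph V) (D : Multiset (Sym2 V)) : Multigraph V where
  edges := G.edges - D
  loopless e he := G.loopless e (Multiset.mem_of_le (Multiset.sub_le_self _ _) he)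

/-- A vertex cut: a proper subset `S` of the vertices whose removal leaves a graph with at least
two connected components, or the graph on a single vertex. -/
def IsVertexCut (G : Multigraph V) (S : Finset V) : Prop :=
  (S : Set V) ≠ Set.univ ∧
    (¬ (G.toSimple.induce (S : Set V)ᶜ).Preconnected ∨ ((S : Set V)ᶜ).ncard = 1)

/-- The vertex-connectivity `κ(G)`: the smallest cardinality of a vertex cut. -/
def vertexConnectivity (G : Multigraph V) : ℕ :=
  sInf {k | ∃ S : Finset V, G.IsVertexCut S ∧ S.card = k}

/-- An edge cut: a sub-multiset `D` of the edges whose removal leaves a disconnected graph, or the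
graph on a single vertex. -/
def IsEdgeCut (G : Multigraph V) (D : Multiset (Sym2 V)) : Prop :=
  D ≤ G.edges ∧ (¬ (G.deleteEdges D).toSimple.Preconnected ∨ Nat.card V = 1)

/-- The edge-connectivity `λ(G)`: the smallest cardinality of an edge cut. -/
def edgeConnectivity (G : Multigraph V) : ℕ :=
  sInf {k | ∃ D : Multiset (Sym2 V), G.IsEdgeCut D ∧ D.card = k}

/-- The Cartesian product: a copy `{u} □ H` of `H` for every vertex `u` of `G`, and a copy
`G □ {w}` of `G` for every vertex `w` of `H`. -/
def boxProd [Fintype V] [Fintype W] (G : Multigraph V) (H : Multigraph W) :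
    Multigraph (V × W) where
  edges := (∑ u : V, H.edges.map (Sym2.map (fun w => (u, w)))) +
    ∑ w : W, G.edges.map (Sym2.map (fun u => (u, w)))
  loopless e he := by
    rw [Multiset.mem_add, Multiset.mem_sum, Multiset.mem_sum] at he
    rcases he with ⟨u, -, h⟩ | ⟨w, -, h⟩
    · obtain ⟨f, hf, rfl⟩ := Multiset.mem_map.1 h
      have := H.loopless f hf
      rwa [Sym2.isDiag_map (fun a b hab => (Prod.mk.inj hab).2)]
    · obtain ⟨f, hf, rfl⟩ := Multiset.mem_map.1 h
      have := G.loopless f hf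
      rwa [Sym2.isDiag_map (fun a b hab => (Prod.mk.inj hab).1)]

/-! ### Scrambles -/

/-- A scramble: a collection of connected nonempty vertex subsets, called eggs. -/
structure Scramble (G : Multigraph V) where
  /-- The eggs. -/
  eggs : Set (Set V)
  connected : ∀ E ∈ eggs, G.ConnectedSet E

/-- `C` is a hitting set for (covers) the scramble: it meets every egg. -/
def Scramble.IsHittingSet {G : Multigraph V} (S : G.Scramble) (C : Finset V) : Prop :=
  ∀ E ∈ S.eggs, ∃ v ∈ C, v ∈ E

/-- `A` is an egg-cut: one egg lies inside `A` and another one in its complement. -/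
def Scramble.IsEggCut {G : Multigraph V} (S : G.Scramble) (A : Set V) : Prop :=
  ∃ E ∈ S.eggs, ∃ E' ∈ S.eggs, E ⊆ A ∧ E' ⊆ Aᶜ

/-- The order of a scramble: the maximum `k` such that no set of size less than `k` is a hitting
set and every egg-cut has size at least `k`. -/
def Scramble.order {G : Multigraph V} (S : G.Scramble) : ℕ :=
  sSup {k | (∀ C : Finset V, C.card < k → ¬ S.IsHittingSet C) ∧
    ∀ A : Set V, S.IsEggCut A → k ≤ G.cutSize A}

/-- The scramble number: the maximum order of a scramble. -/
def scrambleNumber (G : Multigraph V) : ℕ := sSup (Set.range (Scramble.order (G := G)))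

/-! ### Divisors, chip-firing and gonality -/

/-- The degree of a divisor `D : V → ℤ`. -/
def deg [Fintype V] (D : V → ℤ) : ℤ := ∑ v, D v

open Classical in
/-- The divisor obtained from `D` by chip-firing the vertex `w`. -/
def fire (G : Multigraph V) (w : V) (D : V → ℤ) : V → ℤ :=
  fun v => if v = w then D w - G.val w else D v + G.mult v w

/-- Two divisors are equivalent if the second one is obtained from the first one by a finite
sequence of chip-firing moves. -/
def Equivalent (G : Multigraph V) : (V → ℤ) → (V → ℤ) → Prop :=
  Relation.ReflTransGen (fun D D' => ∃ w, D' = G.fire w D)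

/-- `D` is equivalent to an effective divisor. -/
def EquivEffective (G : Multigraph V) (D : V → ℤ) : Prop := ∃ F, 0 ≤ F ∧ G.Equivalent D F

open Classical in
/-- The rank of a divisor: `-1` if it is not equivalent to an effective divisor, and otherwise the
maximum `r` such that `D - E` is equivalent to an effective divisor for every effective `E` of
degree `r`. -/
def rank [Fintype V] (G : Multigraph V) (D : V → ℤ) : ℤ :=
  if G.EquivEffective D then
    ((sSup {r : ℕ | ∀ E : V → ℤ, 0 ≤ E → deg E = r → G.EquivEffective (D - E)} : ℕ) : ℤ)
  else -1

/-- The gonality: the minimum degree of a divisor of positive rank. (Such a divisor has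
nonnegative degree.) -/
def gonality [Fintype V] (G : Multigraph V) : ℕ :=
  sInf {d : ℕ | ∃ D : V → ℤ, 0 < G.rank D ∧ deg D = d}

end

end Multigraph

namespace Multigraph

noncomputable section

open Classical

variable {V W : Type*}

/-! ### Edge multiplicities -/

theorem mult_comm (G : Multigraph V) (u v : V) : G.mult u v = G.mult v u := by
  unfold mult
  rw [Sym2.eq_swap]

theorem mult_self (G : Multigraph V) (u : V) : G.mult u u = 0 := by
  unfold mult
  rw [Multiset.count_eq_zero]
  exact fun h => G.loopless _ h (by simp)

theorem mult_pos_iff (G : Multigraph V) (u v : V) : 0 < G.mult u v ↔ G.toSimple.Adj u v := by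
  unfold mult
  rw [Multiset.count_pos]
  rfl

theorem card_filter_mem_eq_sum_count [Fintype V] (v : V) (s : Multiset (Sym2 V))
    (hs : ∀ e ∈ s, ¬ e.IsDiag) :
    (s.filter (fun e => v ∈ e)).card = ∑ w, s.count s(v, w) := by
  induction s using Multiset.induction with
  | empty => simp
  | cons e s ih =>
    have ih := ih (fun e' he' => hs e' (Multiset.mem_cons_of_mem he'))
    have he := hs e (Multiset.mem_cons_self e s)
    simp only [Multiset.count_cons, Finset.sum_add_distrib, ← ih]
    by_cases hv : v ∈ e
    · obtain ⟨b, rfl⟩ := hv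
      have hvb : v ≠ b := fun h => he (by simp [h])
      simp [hvb]
    · rw [Multiset.filter_cons_of_neg (p := fun e => v ∈ e) _ hv, Finset.sum_eq_zero, add_zero]
      intro w _
      rw [if_neg]
      rintro rfl
      exact hv (by simp)

theorem card_filter_cross_eq_sum_count [Fintype V] (A : Set V) (s : Multiset (Sym2 V)) :
    (s.filter (fun e => ∃ x ∈ A, ∃ y ∉ A, e = s(x, y))).card =
      ∑ x, ∑ y, if x ∈ A ∧ y ∉ A then s.count s(x, y) else 0 := by
  induction s using Multiset.induction with
  | empty => simp
  | cons e s ih =>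
    have key : (∑ x, ∑ y, if x ∈ A ∧ y ∉ A then (e ::ₘ s).count s(x, y) else 0) =
        (∑ x, ∑ y, if x ∈ A ∧ y ∉ A then s.count s(x, y) else 0) +
          ∑ x, ∑ y, if x ∈ A ∧ y ∉ A ∧ s(x, y) = e then 1 else 0 := by
      simp only [← Finset.sum_add_distrib, Multiset.count_cons]
      refine Finset.sum_congr rfl fun x _ => Finset.sum_congr rfl fun y _ => ?_
      split_ifs <;> simp_all
    rw [key, ← ih]
    by_cases h : ∃ x ∈ A, ∃ y ∉ A, e = s(x, y)
    · rw [Multiset.filter_cons_of_pos (p := fun e => ∃ x ∈ A, ∃ y ∉ A, e = s(x, y)) _ h, Multiset.card_cons]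
      obtain ⟨a, ha, b, hb, rfl⟩ := h
      congr 1
      rw [Finset.sum_eq_single a, Finset.sum_eq_single b]
      · simp [ha, hb]
      · intro y _ hy
        refine if_neg fun h => hy ?_
        exact Sym2.congr_right.1 h.2.2
      · simp
      · intro x _ hx
        refine Finset.sum_eq_zero fun y _ => if_neg ?_
        rintro ⟨hxA, hyA, h⟩
        rcases Sym2.eq_iff.1 h with ⟨rfl, rfl⟩ | ⟨rfl, rfl⟩
        · exact hx rfl
        · exact hb hxA
      · simp
    · rw [Multiset.filter_cons_of_neg (p := fun e => ∃ x ∈ A, ∃ y ∉ A, e = s(x, y)) _ h,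
        Finset.sum_eq_zero, add_zero]
      intro x _
      refine Finset.sum_eq_zero fun y _ => if_neg ?_
      rintro ⟨hx, hy, rfl⟩
      exact h ⟨x, hx, y, hy, rfl⟩

theorem val_eq_sum_mult [Fintype V] (G : Multigraph V) (v : V) : G.val v = ∑ w, G.mult v w :=
  card_filter_mem_eq_sum_count v G.edges G.loopless

theorem cutSize_eq_sum_mult [Fintype V] (G : Multigraph V) (A : Set V) :
    G.cutSize A = ∑ x, ∑ y, if x ∈ A ∧ y ∉ A then G.mult x y else 0 := by
  unfold cutSize mult
  convert card_filter_cross_eq_sum_count A G.edges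

theorem cutSize_compl [Fintype V] (G : Multigraph V) (A : Set V) :
    G.cutSize Aᶜ = G.cutSize A := by
  rw [cutSize_eq_sum_mult, cutSize_eq_sum_mult, Finset.sum_comm]
  refine Finset.sum_congr rfl fun x _ => Finset.sum_congr rfl fun y _ => ?_
  rw [G.mult_comm y x]
  simp [and_comm]

theorem cutSize_singleton [Fintype V] (G : Multigraph V) (u : V) :
    G.cutSize {u} = G.val u := by
  rw [cutSize_eq_sum_mult, val_eq_sum_mult, Finset.sum_eq_single u]
  · refine Finset.sum_congr rfl fun y _ => ?_
    by_cases h : y = u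
    · simp [h, mult_self]
    · simp [h]
  · intro x _ hx
    simp [hx]
  · simp

theorem minVal_le_cutSize_singleton [Fintype V] (G : Multigraph V) (u : V) :
    G.minVal ≤ G.cutSize {u} := by
  rw [cutSize_singleton]
  exact Nat.sInf_le ⟨u, rfl⟩

theorem edgeConnectivity_le_cutSize (G : Multigraph V) {A : Set V} {a b : V} (ha : a ∈ A)
    (hb : b ∉ A) : G.edgeConnectivity ≤ G.cutSize A := by
  refine Nat.sInf_le ⟨G.edges.filter (fun e => ∃ x ∈ A, ∃ y ∉ A, e = s(x, y)), ⟨?_, ?_⟩, rfl⟩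
  · exact Multiset.filter_le _ _
  left
  intro hc
  have key : ∀ x y, (G.deleteEdges
      (G.edges.filter (fun e => ∃ x ∈ A, ∃ y ∉ A, e = s(x, y)))).toSimple.Walk x y →
      x ∈ A → y ∈ A := by
    intro x y p
    induction p with
    | nil => exact id
    | @cons x z y h p ih =>
      intro hx
      refine ih ?_
      by_contra hz
      have h' : s(x, z) ∈ G.edges -
        G.edges.filter (fun e => ∃ x ∈ A, ∃ y ∉ A, e = s(x, y)) := h
      rw [← Multiset.count_pos, Multiset.count_sub,
        Multiset.count_filter_of_pos ⟨x, hx, z, hz, rfl⟩] at h'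
      omega
  exact hb (key a b (hc a b).some ha)

/-! ### Cartesian products -/

theorem mult_boxProd [Fintype V] [Fintype W] (G : Multigraph V) (H : Multigraph W)
    (p q : V × W) : (G.boxProd H).mult p q =
      (if p.1 = q.1 then H.mult p.2 q.2 else 0) + if p.2 = q.2 then G.mult p.1 q.1 else 0 := by
  obtain ⟨x, y⟩ := p
  obtain ⟨x', y'⟩ := q
  have h1 : ∀ u : V, (H.edges.map (Sym2.map (fun w => (u, w)))).count s((x, y), (x', y')) =
      if u = x then (if x = x' then H.mult y y' else 0) else 0 := by
    intro u
    by_cases h : u = x ∧ x = x'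
    · obtain ⟨rfl, rfl⟩ := h
      simp only [if_true]
      exact Multiset.count_map_eq_count' (Sym2.map (fun w => (u, w))) _
        (Sym2.map.injective (Prod.mk_right_injective u)) s(y, y')
    · rw [Multiset.count_eq_zero_of_notMem]
      · by_cases h1 : u = x
        · rw [if_pos h1, if_neg (fun h2 => h ⟨h1, h2⟩)]
        · rw [if_neg h1]
      · intro hm
        obtain ⟨e, -, he⟩ := Multiset.mem_map.1 hm
        induction e using Sym2.ind with
        | h a b =>
          simp only [Sym2.map_mk, Sym2.eq_iff, Prod.mk.injEq] at he
          grind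
  have h2 : ∀ w : W, (G.edges.map (Sym2.map (fun u => (u, w)))).count s((x, y), (x', y')) =
      if w = y then (if y = y' then G.mult x x' else 0) else 0 := by
    intro w
    by_cases h : w = y ∧ y = y'
    · obtain ⟨rfl, rfl⟩ := h
      simp only [if_true]
      exact Multiset.count_map_eq_count' (Sym2.map (fun u => (u, w))) _
        (Sym2.map.injective (Prod.mk_left_injective w)) s(x, x')
    · rw [Multiset.count_eq_zero_of_notMem]
      · by_cases h1 : w = y
        · rw [if_pos h1, if_neg (fun h2 => h ⟨h1, h2⟩)]
        · rw [if_neg h1]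
      · intro hm
        obtain ⟨e, -, he⟩ := Multiset.mem_map.1 hm
        induction e using Sym2.ind with
        | h a b =>
          simp only [Sym2.map_mk, Sym2.eq_iff, Prod.mk.injEq] at he
          grind
  have h0 : (G.boxProd H).mult (x, y) (x', y') = Multiset.count s((x, y), (x', y'))
      (∑ u : V, H.edges.map (Sym2.map (fun w => (u, w))) +
        ∑ w : W, G.edges.map (Sym2.map (fun u => (u, w)))) := by
    unfold mult
    congr!
  rw [h0, Multiset.count_add, Multiset.count_sum', Multiset.count_sum']
  simp only [h1, h2, Finset.sum_ite_eq', Finset.mem_univ, if_true]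

theorem cutSize_boxProd [Fintype V] [Fintype W] (G : Multigraph V) (H : Multigraph W)
    (A : Set (V × W)) : (G.boxProd H).cutSize A =
      ∑ u, H.cutSize {w | (u, w) ∈ A} + ∑ w, G.cutSize {u | (u, w) ∈ A} := by
  simp only [cutSize_eq_sum_mult, mult_boxProd, Fintype.sum_prod_type, Set.mem_ofPred_eq]
  rw [Finset.sum_comm (f := fun w u => ∑ u', if (u, w) ∈ A ∧ (u', w) ∉ A then G.mult u u' else 0)]
  simp only [← Finset.sum_add_distrib]
  refine Finset.sum_congr rfl fun u _ => Finset.sum_congr rfl fun w _ => ?_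
  have h1 : ∀ u' w', (if (u, w) ∈ A ∧ (u', w') ∉ A then
      (if u = u' then H.mult w w' else 0) + (if w = w' then G.mult u u' else 0) else 0) =
      (if u = u' then (if (u, w) ∈ A ∧ (u', w') ∉ A then H.mult w w' else 0) else 0) +
      (if w = w' then (if (u, w) ∈ A ∧ (u', w') ∉ A then G.mult u u' else 0) else 0) := by
    intro u' w'
    split_ifs <;> simp
  simp only [h1, Finset.sum_add_distrib]
  congr 1
  · rw [Finset.sum_comm]
    simp
  · simp

/-! ### Chip-firing and the Laplacian -/

/-- The Laplacian of the integer-valued function `f`. -/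
def laplacian [Fintype V] (G : Multigraph V) (f : V → ℤ) (v : V) : ℤ :=
  ∑ w, (G.mult v w : ℤ) * (f v - f w)

theorem laplacian_add [Fintype V] (G : Multigraph V) (f g : V → ℤ) :
    G.laplacian (f + g) = G.laplacian f + G.laplacian g := by
  ext v
  simp only [laplacian, Pi.add_apply, ← Finset.sum_add_distrib]
  exact Finset.sum_congr rfl fun w _ => by ring

theorem laplacian_sub [Fintype V] (G : Multigraph V) (f g : V → ℤ) :
    G.laplacian (f - g) = G.laplacian f - G.laplacian g := by
  rw [eq_sub_iff_add_eq, ← laplacian_add, sub_add_cancel]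

theorem laplacian_add_const [Fintype V] (G : Multigraph V) (f : V → ℤ) (c : ℤ) :
    G.laplacian (fun v => f v + c) = G.laplacian f := by
  ext v
  simp [laplacian]

theorem deg_laplacian [Fintype V] (G : Multigraph V) (f : V → ℤ) : deg (G.laplacian f) = 0 := by
  unfold deg laplacian
  have h : ∑ v, ∑ w, (G.mult v w : ℤ) * (f v - f w) =
      -∑ v, ∑ w, (G.mult v w : ℤ) * (f v - f w) := by
    conv_lhs => rw [Finset.sum_comm]
    simp only [← Finset.sum_neg_distrib]
    refine Finset.sum_congr rfl fun v _ => Finset.sum_congr rfl fun w _ => ?_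
    rw [G.mult_comm w v]
    ring
  omega

theorem deg_sub [Fintype V] (D E : V → ℤ) : deg (D - E) = deg D - deg E := by
  simp [deg]

theorem fire_eq_sub_laplacian [Fintype V] (G : Multigraph V) (w : V) (D : V → ℤ) :
    G.fire w D = D - G.laplacian (Pi.single w 1) := by
  ext v
  simp only [fire, laplacian, Pi.sub_apply]
  by_cases h : v = w
  · subst h
    rw [if_pos rfl, val_eq_sum_mult]
    push_cast
    congr 1
    refine Finset.sum_congr rfl fun x _ => ?_
    by_cases hx : x = v
    · simp [hx, mult_self]
    · simp [hx]
  · rw [if_neg h, Finset.sum_eq_single w]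
    · simp [h]
    · intro x _ hx
      simp [h, hx]
    · simp

theorem equivalent_sub_laplacian_natCast [Fintype V] (G : Multigraph V) (D : V → ℤ)
    (n : ℕ) (f : V → ℕ) (hn : ∑ v, f v = n) :
    G.Equivalent D (D - G.laplacian (fun v => (f v : ℤ))) := by
  induction n generalizing f with
  | zero =>
    have hf : ∀ v, f v = 0 := by simpa using hn
    have : D - G.laplacian (fun v => (f v : ℤ)) = D := by
      ext v
      simp [laplacian, hf]
    rw [this]
    exact Relation.ReflTransGen.refl
  | succ n ih =>
    obtain ⟨w, hw⟩ : ∃ w, 0 < f w := by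
      by_contra! h
      have : ∑ v, f v = 0 := Finset.sum_eq_zero fun v _ => Nat.le_zero.1 (h v)
      omega
    have hf : f = (f - Pi.single w 1) + Pi.single w 1 := by
      ext v
      by_cases h : v = w
      · subst h
        simp
        omega
      · simp [h]
    have hsum : ∑ v, (f - Pi.single w 1 : V → ℕ) v = n := by
      have h2 : ∑ v, f v = ∑ v, (f - Pi.single w 1 : V → ℕ) v + 1 := by
        conv_lhs => rw [hf]
        simp [Finset.sum_add_distrib]
      omega
    refine Relation.ReflTransGen.tail (ih _ hsum) ⟨w, ?_⟩
    rw [fire_eq_sub_laplacian, sub_sub, ← laplacian_add]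
    congr 2
    ext v
    have := congrFun hf v
    conv_lhs => rw [this]
    by_cases h : v = w
    · subst h
      simp
    · simp [h]

theorem equivalent_sub_laplacian [Fintype V] (G : Multigraph V) (D f : V → ℤ) :
    G.Equivalent D (D - G.laplacian f) := by
  obtain ⟨c, hc⟩ : ∃ c : ℤ, ∀ v, 0 ≤ f v + c := by
    refine ⟨∑ v, |f v|, fun v => ?_⟩
    have := Finset.single_le_sum (f := fun v => |f v|) (fun v _ => abs_nonneg (f v))
      (Finset.mem_univ v)
    have := neg_abs_le (f v)
    omega
  have := G.equivalent_sub_laplacian_natCast D _ (fun v => (f v + c).toNat) rfl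
  simp only [Int.toNat_of_nonneg (hc _), laplacian_add_const] at this
  exact this

theorem equivalent_iff [Fintype V] (G : Multigraph V) (D F : V → ℤ) :
    G.Equivalent D F ↔ ∃ f : V → ℤ, F = D - G.laplacian f := by
  constructor
  · intro h
    induction h with
    | refl => exact ⟨0, by ext; simp [laplacian]⟩
    | tail _ h ih =>
      obtain ⟨f, rfl⟩ := ih
      obtain ⟨w, rfl⟩ := h
      exact ⟨f + Pi.single w 1, by rw [fire_eq_sub_laplacian, laplacian_add, sub_sub]⟩
  · rintro ⟨f, rfl⟩
    exact G.equivalent_sub_laplacian D f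

theorem equivEffective_iff [Fintype V] (G : Multigraph V) (D : V → ℤ) :
    G.EquivEffective D ↔ ∃ f : V → ℤ, 0 ≤ D - G.laplacian f := by
  constructor
  · rintro ⟨F, hF, h⟩
    obtain ⟨f, rfl⟩ := (G.equivalent_iff D F).1 h
    exact ⟨f, hF⟩
  · rintro ⟨f, hf⟩
    exact ⟨_, hf, G.equivalent_sub_laplacian D f⟩

theorem deg_nonneg [Fintype V] {D : V → ℤ} (h : 0 ≤ D) : 0 ≤ deg D :=
  Finset.sum_nonneg fun v _ => h v

theorem EquivEffective.deg_nonneg [Fintype V] {G : Multigraph V} {D : V → ℤ}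
    (h : G.EquivEffective D) : 0 ≤ deg D := by
  obtain ⟨f, hf⟩ := (G.equivEffective_iff D).1 h
  have := Multigraph.deg_nonneg hf
  rwa [deg_sub, deg_laplacian, sub_zero] at this

/-- A divisor has positive rank exactly when every vertex carries a chip in some effective
equivalent divisor. -/
theorem rank_pos_iff [Fintype V] [Nonempty V] (G : Multigraph V) (D : V → ℤ) :
    0 < G.rank D ↔ ∀ v, ∃ f : V → ℤ, 0 ≤ D - G.laplacian f ∧ 0 < (D - G.laplacian f) v := by
  constructor
  · intro h v
    unfold rank at h
    split_ifs at h with hD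
    swap
    · omega
    have hpos : 0 < sSup {r : ℕ | ∀ E : V → ℤ, 0 ≤ E → deg E = r → G.EquivEffective (D - E)} := by
      exact_mod_cast h
    obtain ⟨r, hr, hr0⟩ : ∃ r ∈ {r : ℕ | ∀ E : V → ℤ, 0 ≤ E → deg E = r →
        G.EquivEffective (D - E)}, 0 < r := by
      by_contra! hc
      have : sSup {r : ℕ | ∀ E : V → ℤ, 0 ≤ E → deg E = r → G.EquivEffective (D - E)} ≤ 0 := by
        rcases Set.eq_empty_or_nonempty {r : ℕ | ∀ E : V → ℤ, 0 ≤ E → deg E = r →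
          G.EquivEffective (D - E)} with h0 | h0
        · rw [h0]
          simp
        · exact csSup_le h0 hc
      omega
    have hE := hr (Pi.single v (r : ℤ)) (by simp [Pi.single_nonneg]) (by simp [deg])
    obtain ⟨f, hf⟩ := (G.equivEffective_iff _).1 hE
    refine ⟨f, fun x => ?_, ?_⟩
    · have := hf x
      have h1 : (0 : ℤ) ≤ (Pi.single v (r : ℤ) : V → ℤ) x := by
        have : (0 : V → ℤ) ≤ Pi.single v (r : ℤ) := by simp [Pi.single_nonneg]
        exact this x
      simp only [Pi.zero_apply, Pi.sub_apply] at *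
      omega
    · have := hf v
      simp only [Pi.zero_apply, Pi.sub_apply, Pi.single_eq_same] at *
      omega
  · intro h
    have hD : G.EquivEffective D := by
      obtain ⟨f, hf, -⟩ := h (Classical.arbitrary V)
      exact (G.equivEffective_iff D).2 ⟨f, hf⟩
    unfold rank
    rw [if_pos hD]
    have hmem : 1 ∈ {r : ℕ | ∀ E : V → ℤ, 0 ≤ E → deg E = r → G.EquivEffective (D - E)} := by
      intro E hE hdeg
      obtain ⟨v, hv⟩ : ∃ v, 0 < E v := by
        by_contra! hc
        have : deg E ≤ 0 := Finset.sum_nonpos fun v _ => hc v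
        rw [hdeg] at this
        norm_num at this
      have hE1 : ∀ x, x ≠ v → E x = 0 ∧ E v = 1 := by
        intro x hx
        have h1 : E v + E x ≤ deg E := by
          unfold deg
          rw [← Finset.sum_pair (Ne.symm hx)]
          exact Finset.sum_le_sum_of_subset_of_nonneg (Finset.subset_univ _) fun i _ _ => hE i
        have h2 := hE x
        simp only [Pi.zero_apply] at h2
        push_cast at hdeg
        omega
      have hv1 : E v ≤ 1 := by
        have : E v ≤ deg E := Finset.single_le_sum (fun i _ => hE i) (Finset.mem_univ v)
        push_cast at hdeg
        omega
      obtain ⟨f, hf, hfv⟩ := h v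
      refine (G.equivEffective_iff _).2 ⟨f, fun x => ?_⟩
      have h3 := hf x
      by_cases hx : x = v
      · subst hx
        simp only [Pi.zero_apply, Pi.sub_apply] at *
        omega
      · have := (hE1 x hx).1
        simp only [Pi.zero_apply, Pi.sub_apply] at *
        omega
    have hbdd : BddAbove {r : ℕ | ∀ E : V → ℤ, 0 ≤ E → deg E = r → G.EquivEffective (D - E)} := by
      refine ⟨(deg D).toNat, fun r hr => ?_⟩
      have h1 := (hr (Pi.single (Classical.arbitrary V) (r : ℤ)) (by simp [Pi.single_nonneg])
        (by simp [deg])).deg_nonneg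
      have h2 : deg (Pi.single (Classical.arbitrary V) (r : ℤ) : V → ℤ) = r := by simp [deg]
      rw [deg_sub, h2] at h1
      omega
    have := le_csSup hbdd hmem
    exact_mod_cast this

/-! ### Gonality -/

theorem exists_deg_eq_gonality [Fintype V] [Nonempty V] (G : Multigraph V) :
    ∃ D : V → ℤ, 0 < G.rank D ∧ deg D = G.gonality := by
  refine Nat.sInf_mem (s := {d : ℕ | ∃ D : V → ℤ, 0 < G.rank D ∧ deg D = d})
    ⟨Fintype.card V, fun _ => 1, ?_, by simp [deg]⟩
  rw [rank_pos_iff]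
  refine fun v => ⟨0, ?_, ?_⟩
  · intro x
    simp [laplacian]
  · simp [laplacian]

theorem gonality_pos [Fintype V] [Nonempty V] (G : Multigraph V) : 0 < G.gonality := by
  obtain ⟨D, hD, hdeg⟩ := G.exists_deg_eq_gonality
  obtain ⟨f, hf, hfv⟩ := (G.rank_pos_iff D).1 hD (Classical.arbitrary V)
  have h1 : deg (D - G.laplacian f) = G.gonality := by
    rw [deg_sub, deg_laplacian, sub_zero, hdeg]
  have h2 : 0 < deg (D - G.laplacian f) :=
    Finset.sum_pos' (fun v _ => hf v) ⟨_, Finset.mem_univ _, hfv⟩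
  omega

theorem laplacian_boxProd_fst [Fintype V] [Fintype W] (G : Multigraph V) (H : Multigraph W)
    (f : V → ℤ) : (G.boxProd H).laplacian (fun p => f p.1) = fun p => G.laplacian f p.1 := by
  ext ⟨u, w⟩
  simp only [laplacian, mult_boxProd, Fintype.sum_prod_type]
  refine Finset.sum_congr rfl fun u' _ => ?_
  rw [Finset.sum_eq_single w]
  · by_cases h : u = u'
    · simp [h]
    · simp [h]
  · intro w' _ hw
    by_cases h : u = u'
    · simp [h]
    · simp [h, hw.symm]
  · simp

theorem laplacian_boxProd_snd [Fintype V] [Fintype W] (G : Multigraph V) (H : Multigraph W)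
    (f : W → ℤ) : (G.boxProd H).laplacian (fun p => f p.2) = fun p => H.laplacian f p.2 := by
  ext ⟨u, w⟩
  simp only [laplacian, mult_boxProd, Fintype.sum_prod_type]
  rw [Finset.sum_comm]
  refine Finset.sum_congr rfl fun w' _ => ?_
  rw [Finset.sum_eq_single u]
  · by_cases h : w = w'
    · simp [h]
    · simp [h]
  · intro u' _ hu
    by_cases h : w = w'
    · simp [h]
    · simp [h, hu.symm]
  · simp

theorem gonality_boxProd_le_left [Fintype V] [Fintype W] [Nonempty V] [Nonempty W]
    (G : Multigraph V) (H : Multigraph W) :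
    (G.boxProd H).gonality ≤ G.gonality * Fintype.card W := by
  obtain ⟨D, hD, hdeg⟩ := G.exists_deg_eq_gonality
  refine Nat.sInf_le ⟨fun p => D p.1, ?_, ?_⟩
  · rw [rank_pos_iff]
    rintro ⟨v, w⟩
    obtain ⟨f, hf, hfv⟩ := (G.rank_pos_iff D).1 hD v
    refine ⟨fun p => f p.1, ?_, ?_⟩
    · rw [laplacian_boxProd_fst]
      exact fun p => hf p.1
    · rw [laplacian_boxProd_fst]
      exact hfv
  · push_cast
    rw [← hdeg, mul_comm]
    simp [deg, Fintype.sum_prod_type, Finset.mul_sum]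

theorem gonality_boxProd_le_right [Fintype V] [Fintype W] [Nonempty V] [Nonempty W]
    (G : Multigraph V) (H : Multigraph W) :
    (G.boxProd H).gonality ≤ Fintype.card V * H.gonality := by
  obtain ⟨D, hD, hdeg⟩ := H.exists_deg_eq_gonality
  refine Nat.sInf_le ⟨fun p => D p.2, ?_, ?_⟩
  · rw [rank_pos_iff]
    rintro ⟨v, w⟩
    obtain ⟨f, hf, hfv⟩ := (H.rank_pos_iff D).1 hD w
    refine ⟨fun p => f p.2, ?_, ?_⟩
    · rw [laplacian_boxProd_snd]
      exact fun p => hf p.2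
    · rw [laplacian_boxProd_snd]
      exact hfv
  · push_cast
    rw [← hdeg]
    simp [deg, Fintype.sum_prod_type]

/-! ### Scramble number and gonality -/

/-- The Laplacian of an indicator function counts, inside the set, the edges leaving it. -/
theorem laplacian_indicator_of_mem [Fintype V] (G : Multigraph V) (U : Set V) {v : V}
    (hv : v ∈ U) : G.laplacian (U.indicator 1) v = ∑ w, if w ∉ U then (G.mult v w : ℤ) else 0 := by
  unfold laplacian
  refine Finset.sum_congr rfl fun w _ => ?_
  by_cases hw : w ∈ U <;> simp [hv, hw]

theorem laplacian_indicator_of_notMem [Fintype V] (G : Multigraph V) (U : Set V) {v : V}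
    (hv : v ∉ U) :
    G.laplacian (U.indicator 1) v = -∑ w, if w ∈ U then (G.mult v w : ℤ) else 0 := by
  unfold laplacian
  rw [← Finset.sum_neg_distrib]
  refine Finset.sum_congr rfl fun w _ => ?_
  by_cases hw : w ∈ U <;> simp [hv, hw]

theorem laplacian_indicator_nonpos [Fintype V] (G : Multigraph V) (U : Set V) {v : V}
    (hv : v ∉ U) : G.laplacian (U.indicator 1) v ≤ 0 := by
  rw [laplacian_indicator_of_notMem G U hv, neg_nonpos]
  exact Finset.sum_nonneg fun w _ => by split_ifs <;> simp

/-- A connected set that meets both `U` and its complement has an edge joining the two. -/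
theorem ConnectedSet.exists_mult_pos {G : Multigraph V} {E U : Set V} (hE : G.ConnectedSet E)
    {a b : V} (ha : a ∈ E) (haU : a ∈ U) (hb : b ∈ E) (hbU : b ∉ U) :
    ∃ x ∈ E, ∃ y ∈ E, x ∈ U ∧ y ∉ U ∧ 0 < G.mult x y := by
  by_contra! hc
  have key : ∀ x y : E, (G.toSimple.induce E).Walk x y → (x : V) ∈ U → (y : V) ∈ U := by
    intro x y p
    induction p with
    | nil => exact id
    | @cons x z y h p ih =>
      intro hx
      refine ih ?_
      by_contra hz
      have h1 := hc x x.2 z z.2 hx hz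
      have h2 : 0 < G.mult x z := (G.mult_pos_iff _ _).2 h
      omega
  exact hbU (key ⟨a, ha⟩ ⟨b, hb⟩ (hE.preconnected ⟨a, ha⟩ ⟨b, hb⟩).some haU)

theorem cutSize_le_deg [Fintype V] (G : Multigraph V) {D : V → ℤ} {U : Set V} (hD : 0 ≤ D)
    (hU : 0 ≤ D - G.laplacian (U.indicator 1)) : (G.cutSize U : ℤ) ≤ deg D := by
  rw [cutSize_eq_sum_mult]
  push_cast
  refine Finset.sum_le_sum fun v _ => ?_
  by_cases hv : v ∈ U
  · have := hU v
    rw [Pi.sub_apply, laplacian_indicator_of_mem G U hv] at this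
    simp only [hv, true_and]
    simpa using this
  · simpa [hv] using hD v

/-- The eggs of a scramble that contain a chip of a divisor. -/
def Scramble.hitEggs {G : Multigraph V} (S : G.Scramble) (D : V → ℤ) : Set (Set V) :=
  {E ∈ S.eggs | ∃ v ∈ E, 0 < D v}

theorem Scramble.exists_isEggCut_le_deg [Fintype V] {G : Multigraph V} (S : G.Scramble)
    {E : Set V} (hE : E ∈ S.eggs) {v : V} (hv : v ∈ E) (n : ℕ) (D : V → ℤ) (f : V → ℕ)
    (hn : ∑ x, f x = n) (hD : 0 ≤ D) (hDE : ∀ x ∈ E, D x ≤ 0)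
    (hf : 0 ≤ D - G.laplacian (fun x => (f x : ℤ)))
    (hfv : 0 < (D - G.laplacian (fun x => (f x : ℤ))) v)
    (hmax : ∀ g : V → ℤ, 0 ≤ D - G.laplacian g →
      (S.hitEggs (D - G.laplacian g)).ncard ≤ (S.hitEggs D).ncard) :
    ∃ U, S.IsEggCut U ∧ (G.cutSize U : ℤ) ≤ deg D := by
  induction n using Nat.strong_induction_on generalizing D f with
  | _ n ih =>
  obtain ⟨m, hm⟩ : ∃ m, ∀ x, f x ≤ f m := by
    obtain ⟨m, -, hm⟩ := Finset.exists_max_image Finset.univ f ⟨v, Finset.mem_univ v⟩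
    exact ⟨m, fun x => hm x (Finset.mem_univ x)⟩
  have hm0 : 0 < f m := by
    by_contra h0
    have hf0 : ∀ x, f x = 0 := fun x => by have := hm x; omega
    have := hDE v hv
    simp [laplacian, hf0] at hfv
    omega
  obtain ⟨U, hUiff⟩ : ∃ U : Set V, ∀ x, x ∈ U ↔ f x = f m := ⟨{x | f x = f m}, fun _ => Iff.rfl⟩
  have hlt : ∀ x, x ∉ U → f x < f m := fun x hx =>
    lt_of_le_of_ne (hm x) fun h => hx ((hUiff x).2 h)
  have hU : 0 ≤ D - G.laplacian (U.indicator 1) := by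
    intro x
    by_cases hx : x ∈ U
    · have h1 := hf x
      have h2 : G.laplacian (U.indicator 1) x ≤ G.laplacian (fun x => (f x : ℤ)) x := by
        rw [laplacian_indicator_of_mem G U hx]
        unfold laplacian
        refine Finset.sum_le_sum fun w _ => ?_
        have hx' : f x = f m := (hUiff x).1 hx
        have hm' : (0 : ℤ) ≤ (f x : ℤ) - f w := by
          have := hm w
          omega
        by_cases hw : w ∈ U
        · simpa [hw] using mul_nonneg (Int.natCast_nonneg (G.mult x w)) hm'
        · have hw' : (1 : ℤ) ≤ (f x : ℤ) - f w := by
            have := hlt w hw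
            omega
          simpa [hw] using le_mul_of_one_le_right (Int.natCast_nonneg (G.mult x w)) hw'
      simp only [Pi.zero_apply, Pi.sub_apply] at *
      omega
    · have h1 := hD x
      have h2 := G.laplacian_indicator_nonpos U hx
      simp only [Pi.zero_apply, Pi.sub_apply] at *
      omega
  by_cases hsub : S.hitEggs D ⊆ S.hitEggs (D - G.laplacian (U.indicator 1))
  · have heq : S.hitEggs D = S.hitEggs (D - G.laplacian (U.indicator 1)) :=
      Set.eq_of_subset_of_ncard_le hsub (hmax _ hU) (Set.toFinite _)
    have hcast : (fun x => ((f x - U.indicator 1 x : ℕ) : ℤ)) =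
        (fun x => (f x : ℤ)) - U.indicator 1 := by
      ext x
      by_cases hx : x ∈ U
      · have hx' : f x = f m := (hUiff x).1 hx
        simp only [Pi.sub_apply, Set.indicator_of_mem hx, Pi.one_apply]
        omega
      · simp [hx]
    have hrest : D - G.laplacian (U.indicator 1) -
        G.laplacian (fun x => ((f x - U.indicator 1 x : ℕ) : ℤ)) =
          D - G.laplacian (fun x => (f x : ℤ)) := by
      rw [hcast, laplacian_sub]
      abel
    have hdeg : deg (D - G.laplacian (U.indicator 1)) = deg D := by
      rw [deg_sub, deg_laplacian, sub_zero]
    rw [← hdeg]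
    refine ih (∑ x, (f x - U.indicator 1 x)) ?_ (D - G.laplacian (U.indicator 1))
      (fun x => f x - U.indicator 1 x) rfl hU ?_ ?_ ?_ ?_
    · rw [← hn]
      refine Finset.sum_lt_sum (fun x _ => Nat.sub_le _ _) ⟨m, Finset.mem_univ m, ?_⟩
      have : m ∈ U := (hUiff m).2 rfl
      simp only [Set.indicator_of_mem this, Pi.one_apply]
      omega
    · by_contra! hc
      obtain ⟨x, hx, hx0⟩ := hc
      have : E ∈ S.hitEggs D := heq ▸ ⟨hE, x, hx, hx0⟩
      obtain ⟨-, y, hy, hy0⟩ := this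
      exact absurd (hDE y hy) (not_le.2 hy0)
    · rw [hrest]
      exact hf
    · rw [hrest]
      exact hfv
    · intro g hg
      rw [← heq]
      rw [sub_sub, ← laplacian_add] at hg ⊢
      exact hmax _ hg
  · rw [Set.not_subset] at hsub
    obtain ⟨E', ⟨hE', y, hy, hy0⟩, hnot⟩ := hsub
    have hzero : ∀ x ∈ E', (D - G.laplacian (U.indicator 1)) x ≤ 0 := by
      intro x hx
      by_contra! hc
      exact hnot ⟨hE', x, hx, hc⟩
    have hyU : y ∈ U := by
      by_contra hyU
      have h1 := G.laplacian_indicator_nonpos U hyU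
      have h2 := hzero y hy
      simp only [Pi.sub_apply] at h2
      omega
    refine ⟨U, ⟨E', hE', E, hE, ?_, ?_⟩, G.cutSize_le_deg hD hU⟩
    · intro z hz
      by_contra hzU
      obtain ⟨a, ha, b, hb, haU, hbU, hab⟩ :=
        (S.connected E' hE').exists_mult_pos hy hyU hz hzU
      have h1 := hzero b hb
      have h2 := hD b
      rw [Pi.sub_apply, laplacian_indicator_of_notMem G U hbU] at h1
      have h3 := Finset.single_le_sum (f := fun w => if w ∈ U then (G.mult b w : ℤ) else 0)
        (fun w _ => by split_ifs <;> simp) (Finset.mem_univ a)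
      simp only [haU, if_true] at h3
      rw [G.mult_comm] at hab
      simp only [Pi.zero_apply] at h2
      omega
    · have hvU : v ∉ U := by
        intro hvU
        have h1 : 0 ≤ G.laplacian (fun x => (f x : ℤ)) v := by
          refine Finset.sum_nonneg fun w _ => mul_nonneg (Int.natCast_nonneg _) ?_
          have hv' : f v = f m := (hUiff v).1 hvU
          have := hm w
          dsimp only
          omega
        have h2 := hDE v hv
        simp only [Pi.sub_apply] at hfv
        omega
      intro z hz hzU
      obtain ⟨a, ha, b, hb, haU, hbU, hab⟩ :=
        (S.connected E hE).exists_mult_pos hz hzU hv hvU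
      have h1 := hU a
      have h2 := hDE a ha
      rw [Pi.sub_apply, laplacian_indicator_of_mem G U haU] at h1
      have h3 := Finset.single_le_sum (f := fun w => if w ∉ U then (G.mult a w : ℤ) else 0)
        (fun w _ => by split_ifs <;> simp) (Finset.mem_univ b)
      simp only [hbU, not_false_eq_true, if_true] at h3
      simp only [Pi.zero_apply] at h1
      omega

theorem Scramble.le_gonality [Fintype V] [Nonempty V] {G : Multigraph V} (S : G.Scramble) {k : ℕ}
    (hhit : ∀ C : Finset V, C.card < k → ¬ S.IsHittingSet C)
    (hcut : ∀ A : Set V, S.IsEggCut A → k ≤ G.cutSize A) : k ≤ G.gonality := by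
  obtain ⟨D₀, hrank, hdeg⟩ := G.exists_deg_eq_gonality
  rw [rank_pos_iff] at hrank
  obtain ⟨f₀, ⟨hf₀, hmax⟩⟩ : ∃ f₀ : V → ℤ, 0 ≤ D₀ - G.laplacian f₀ ∧
      ∀ g : V → ℤ, 0 ≤ D₀ - G.laplacian g →
        (S.hitEggs (D₀ - G.laplacian g)).ncard ≤ (S.hitEggs (D₀ - G.laplacian f₀)).ncard := by
    obtain ⟨f, hf, -⟩ := hrank (Classical.arbitrary V)
    have hfin : (Set.range fun g : V → ℤ => (S.hitEggs (D₀ - G.laplacian g)).ncard).Finite := by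
      refine (Set.finite_Iic (Set.univ : Set (Set V)).ncard).subset ?_
      rintro _ ⟨g, rfl⟩
      exact Set.ncard_le_ncard (Set.subset_univ _) (Set.toFinite _)
    obtain ⟨f₀, h₀, h₁⟩ := Set.exists_max_image
      ((fun g : V → ℤ => (S.hitEggs (D₀ - G.laplacian g)).ncard) '' {g | 0 ≤ D₀ - G.laplacian g})
      id (hfin.subset (Set.image_subset_range _ _)) ⟨_, f, hf, rfl⟩
    obtain ⟨g, hg, rfl⟩ := h₀
    exact ⟨g, hg, fun g' hg' => h₁ _ ⟨g', hg', rfl⟩⟩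
  set D := D₀ - G.laplacian f₀ with hDdef
  have hdegD : deg D = G.gonality := by rw [hDdef, deg_sub, deg_laplacian, sub_zero, hdeg]
  have hshift : ∀ g, D - G.laplacian g = D₀ - G.laplacian (f₀ + g) := by
    intro g
    rw [hDdef, laplacian_add, sub_sub]
  by_cases hS : S.IsHittingSet (Finset.univ.filter fun v => 0 < D v)
  · by_contra! hlt
    refine hhit _ (lt_of_le_of_lt ?_ hlt) hS
    rw [Finset.card_filter]
    zify
    rw [← hdegD]
    refine Finset.sum_le_sum fun v _ => ?_
    have := hf₀ v
    simp only [Pi.zero_apply] at this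
    split_ifs with h
    · omega
    · exact this
  · simp only [Scramble.IsHittingSet, Finset.mem_filter, Finset.mem_univ, true_and] at hS
    push Not at hS
    obtain ⟨E, hE, hED⟩ := hS
    obtain ⟨⟨v, hv⟩⟩ := (S.connected E hE).nonempty
    obtain ⟨f, hf, hfv⟩ := hrank v
    obtain ⟨c, hc⟩ : ∃ c : ℤ, ∀ x, 0 ≤ (f - f₀) x + c := by
      refine ⟨∑ x, |(f - f₀) x|, fun x => ?_⟩
      have := Finset.single_le_sum (f := fun x => |(f - f₀) x|) (fun x _ => abs_nonneg _)
        (Finset.mem_univ x)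
      have := neg_abs_le ((f - f₀) x)
      omega
    have hfe : D - G.laplacian (fun x => ((((f - f₀) x + c).toNat : ℕ) : ℤ)) =
        D₀ - G.laplacian f := by
      simp only [Int.toNat_of_nonneg (hc _)]
      rw [laplacian_add_const, hshift, add_sub_cancel]
    obtain ⟨U, hU, hUdeg⟩ := S.exists_isEggCut_le_deg hE hv _ D
      (fun x => ((f - f₀) x + c).toNat) rfl hf₀
      (fun x hx => not_lt.1 fun h => hED x h hx) (by rw [hfe]; exact hf) (by rw [hfe]; exact hfv)
      (fun g hg => by
        rw [hshift] at hg ⊢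
        exact hmax _ hg)
    have := hcut U hU
    omega

theorem Scramble.order_le_gonality [Fintype V] [Nonempty V] {G : Multigraph V} (S : G.Scramble) :
    S.order ≤ G.gonality :=
  csSup_le ⟨0, by simp⟩ fun _ hk => S.le_gonality hk.1 hk.2

theorem scrambleNumber_le_gonality [Fintype V] [Nonempty V] (G : Multigraph V) :
    G.scrambleNumber ≤ G.gonality :=
  csSup_le ⟨_, ⟨∅, by simp⟩, rfl⟩ fun _ ⟨S, hS⟩ => hS ▸ S.order_le_gonality

theorem Scramble.le_scrambleNumber [Fintype V] [Nonempty V] {G : Multigraph V} (S : G.Scramble)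
    {k : ℕ} (hhit : ∀ C : Finset V, C.card < k → ¬ S.IsHittingSet C)
    (hcut : ∀ A : Set V, S.IsEggCut A → k ≤ G.cutSize A) : k ≤ G.scrambleNumber :=
  (le_csSup ⟨G.gonality, fun _ hk => S.le_gonality hk.1 hk.2⟩ ⟨hhit, hcut⟩ : k ≤ S.order).trans
    (le_csSup ⟨G.gonality, fun _ ⟨S, hS⟩ => hS ▸ S.order_le_gonality⟩ ⟨S, rfl⟩)

/-! ### The scramble of punctured copies of the first factor -/

theorem two_lt_card_of_two_le_vertexConnectivity [Fintype V] [Nonempty V] (G : Multigraph V)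
    (h : 2 ≤ G.vertexConnectivity) : 2 < Fintype.card V := by
  by_contra! hc
  have hcut : G.IsVertexCut (Finset.univ.erase (Classical.arbitrary V)) := by
    have hcompl : ((Finset.univ.erase (Classical.arbitrary V) : Finset V) : Set V)ᶜ =
        {Classical.arbitrary V} := by
      ext x
      simp
    refine ⟨fun hu => ?_, Or.inr (by rw [hcompl, Set.ncard_singleton])⟩
    rw [hu] at hcompl
    simp at hcompl
  have : G.vertexConnectivity ≤ _ := Nat.sInf_le ⟨_, hcut, rfl⟩
  rw [Finset.card_erase_of_mem (Finset.mem_univ _), Finset.card_univ] at this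
  omega

theorem preconnected_induce_compl_singleton [Fintype V] [Nonempty V] (G : Multigraph V)
    (h : 2 ≤ G.vertexConnectivity) (u : V) :
    (G.toSimple.induce ({u}ᶜ : Set V)).Preconnected := by
  by_contra hc
  have hcard := G.two_lt_card_of_two_le_vertexConnectivity h
  have hcut : G.IsVertexCut {u} := by
    refine ⟨fun hu => ?_, Or.inl (by rwa [Finset.coe_singleton])⟩
    rw [Finset.coe_eq_univ] at hu
    have := congrArg Finset.card hu
    rw [Finset.card_singleton, Finset.card_univ] at this
    omega
  have : G.vertexConnectivity ≤ _ := Nat.sInf_le ⟨_, hcut, rfl⟩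
  rw [Finset.card_singleton] at this
  omega

/-- The punctured copy `(G - u) □ {w}` of the first factor. -/
def puncturedFiber (u : V) (w : W) : Set (V × W) := {p | p.1 ≠ u ∧ p.2 = w}

theorem connectedSet_puncturedFiber [Fintype V] [Fintype W] [Nonempty V] (G : Multigraph V)
    (H : Multigraph W) (h : 2 ≤ G.vertexConnectivity) (u : V) (w : W) :
    (G.boxProd H).ConnectedSet (puncturedFiber u w) := by
  have hcard := G.two_lt_card_of_two_le_vertexConnectivity h
  let φ : G.toSimple.induce ({u}ᶜ : Set V) →g
      (G.boxProd H).toSimple.induce (puncturedFiber u w) :=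
    { toFun := fun x => ⟨(x.1, w), x.2, rfl⟩
      map_rel' := by
        intro a b hab
        change (G.boxProd H).toSimple.Adj (a.1, w) (b.1, w)
        have hab' : G.toSimple.Adj a.1 b.1 := hab
        rw [← mult_pos_iff] at hab' ⊢
        rw [mult_boxProd, if_pos (rfl : w = w)]
        exact Nat.lt_of_lt_of_le hab' (Nat.le_add_left _ _) }
  have hpre : ((G.boxProd H).toSimple.induce (puncturedFiber u w)).Preconnected := by
    rintro ⟨⟨a, _⟩, ha, rfl⟩ ⟨⟨b, _⟩, hb, hbw⟩
    cases hbw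
    exact (G.preconnected_induce_compl_singleton h u ⟨a, ha⟩ ⟨b, hb⟩).map φ
  obtain ⟨v, hv⟩ := Fintype.exists_ne_of_one_lt_card (by omega : 1 < Fintype.card V) u
  have : Nonempty (puncturedFiber u w) := ⟨⟨(v, w), hv, rfl⟩⟩
  exact ⟨hpre⟩

/-- The scramble on `G □ H` whose eggs are the punctured copies of `G`. -/
def puncturedScramble [Fintype V] [Fintype W] [Nonempty V] (G : Multigraph V)
    (H : Multigraph W) (h : 2 ≤ G.vertexConnectivity) : (G.boxProd H).Scramble where
  eggs := {E | ∃ u w, E = puncturedFiber u w}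
  connected := by
    rintro _ ⟨u, w, rfl⟩
    exact G.connectedSet_puncturedFiber H h u w

theorem two_mul_card_le_of_isHittingSet [Fintype V] [Fintype W] [Nonempty V] (G : Multigraph V)
    (H : Multigraph W) (h : 2 ≤ G.vertexConnectivity) (C : Finset (V × W))
    (hC : (G.puncturedScramble H h).IsHittingSet C) : 2 * Fintype.card W ≤ C.card := by
  rw [Finset.card_eq_sum_card_fiberwise (f := Prod.snd) (t := Finset.univ)
    (fun _ _ => Finset.mem_coe.2 (Finset.mem_univ _)), mul_comm, ← smul_eq_mul, ← Finset.card_univ]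
  refine Finset.card_nsmul_le_sum _ _ _ fun w _ => ?_
  obtain ⟨p, hp, -, hpw⟩ := hC _ ⟨Classical.arbitrary V, w, rfl⟩
  obtain ⟨q, hq, hqu, hqw⟩ := hC _ ⟨p.1, w, rfl⟩
  exact Finset.one_lt_card.2 ⟨p, Finset.mem_filter.2 ⟨hp, hpw⟩, q, Finset.mem_filter.2 ⟨hq, hqw⟩,
    fun hpq => hqu (by rw [hpq])⟩

theorem exists_le_cutSize_of_isEggCut [Fintype V] [Fintype W] [Nonempty V] (G : Multigraph V)
    (H : Multigraph W) (h : 2 ≤ G.vertexConnectivity) {A : Set (V × W)}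
    (hA : (G.puncturedScramble H h).IsEggCut A) :
    ∃ b : ℕ, b ≤ 2 ∧ (Fintype.card V : ℤ) * H.edgeConnectivity +
      b * ((G.minVal : ℤ) - H.edgeConnectivity) ≤ (G.boxProd H).cutSize A := by
  obtain ⟨_, ⟨u, w, rfl⟩, _, ⟨u', w', rfl⟩, hin, hout⟩ := hA
  have hcard := G.two_lt_card_of_two_le_vertexConnectivity h
  have hin' : ∀ x, x ≠ u → (x, w) ∈ A := fun x hx => hin ⟨hx, rfl⟩
  have hout' : ∀ x, x ≠ u' → (x, w') ∉ A := fun x hx => hout ⟨hx, rfl⟩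
  have hne : w ≠ w' := by
    rintro rfl
    obtain ⟨x, hx⟩ : ∃ x, x ∉ ({u, u'} : Finset V) := by
      by_contra! hall
      have h1 := Finset.card_le_two (a := u) (b := u')
      rw [Finset.eq_univ_of_forall hall, Finset.card_univ] at h1
      omega
    simp only [Finset.mem_insert, Finset.mem_singleton, not_or] at hx
    exact hout' x hx.2 (hin' x hx.1)
  set b₁ : ℕ := if (u, w) ∈ A then 0 else 1 with hb₁
  set b₂ : ℕ := if (u', w') ∈ A then 1 else 0 with hb₂
  refine ⟨b₁ + b₂, by rw [hb₁, hb₂]; split_ifs <;> omega, ?_⟩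
  have hG₁ : b₁ * G.minVal ≤ G.cutSize {x | (x, w) ∈ A} := by
    rw [hb₁]
    split_ifs with hu
    · simp
    · have : {x | (x, w) ∈ A} = {u}ᶜ := by
        ext x
        by_cases hx : x = u
        · simp [hx, hu]
        · simp [hx, hin' x hx]
      rw [this, cutSize_compl, one_mul]
      exact G.minVal_le_cutSize_singleton u
  have hG₂ : b₂ * G.minVal ≤ G.cutSize {x | (x, w') ∈ A} := by
    rw [hb₂]
    split_ifs with hu
    · have : {x | (x, w') ∈ A} = {u'} := by
        ext x
        by_cases hx : x = u'
        · simp [hx, hu]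
        · simp [hx, hout' x hx]
      rw [this, one_mul]
      exact G.minVal_le_cutSize_singleton u'
    · simp
  have hGsum : b₁ * G.minVal + b₂ * G.minVal ≤ ∑ y, G.cutSize {x | (x, y) ∈ A} := by
    refine (add_le_add hG₁ hG₂).trans ?_
    rw [← Finset.sum_pair (f := fun y => G.cutSize {x | (x, y) ∈ A}) hne]
    exact Finset.sum_le_sum_of_subset (Finset.subset_univ _)
  have hHsum : Fintype.card V * H.edgeConnectivity ≤ ∑ x, H.cutSize {y | (x, y) ∈ A} +
      b₁ * H.edgeConnectivity + b₂ * H.edgeConnectivity := by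
    have h1 : b₁ * H.edgeConnectivity = ∑ x, if x = u then b₁ * H.edgeConnectivity else 0 := by
      simp
    have h2 : b₂ * H.edgeConnectivity = ∑ x, if x = u' then b₂ * H.edgeConnectivity else 0 := by
      simp
    rw [h1, h2, ← Finset.sum_add_distrib, ← Finset.sum_add_distrib, ← Finset.card_univ,
      ← smul_eq_mul]
    refine Finset.card_nsmul_le_sum _ _ _ fun x _ => ?_
    by_cases hx : (x, w) ∈ A
    · by_cases hx' : (x, w') ∈ A
      · have hxu : x = u' := by
          by_contra hxu
          exact hout' x hxu hx'
        subst hxu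
        simp [hb₂, hx']
      · have := H.edgeConnectivity_le_cutSize (A := {y | (x, y) ∈ A}) (a := w) (b := w') hx hx'
        omega
    · have hxu : x = u := by
        by_contra hxu
        exact hx (hin' x hxu)
      subst hxu
      simp [hb₁, hx]
      omega
  rw [cutSize_boxProd]
  zify at hGsum hHsum
  push_cast
  linarith

theorem le_scrambleNumber_boxProd [Fintype V] [Fintype W] [Nonempty V] [Nonempty W]
    (G : Multigraph V) (H : Multigraph W) (h : 2 ≤ G.vertexConnectivity) {k : ℕ}
    (hk : k ≤ 2 * Fintype.card W) (hk₀ : k ≤ Fintype.card V * H.edgeConnectivity)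
    (hk₂ : (k : ℤ) ≤ Fintype.card V * H.edgeConnectivity +
      2 * ((G.minVal : ℤ) - H.edgeConnectivity)) :
    k ≤ (G.boxProd H).scrambleNumber := by
  refine (G.puncturedScramble H h).le_scrambleNumber ?_ ?_
  · intro C hC hhit
    have := G.two_mul_card_le_of_isHittingSet H h C hhit
    omega
  · intro A hA
    obtain ⟨b, hb, hle⟩ := G.exists_le_cutSize_of_isEggCut H h hA
    zify at hk₀ ⊢
    interval_cases b <;> push_cast at hle <;> linarith

end

end Multigraph

theorem mainTheorem8 {V W : Type*} [Fintype V] [Fintype W] (G : Multigraph V) (H : Multigraph W)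
    (hG : G.Connected) (hH : H.Connected) (hκ : 2 ≤ G.vertexConnectivity) :
    (G.gonality = 2 →
      H.edgeConnectivity ≠ 0 →
      (Fintype.card W : ℝ) / H.edgeConnectivity ≤ 1 / 2 * Fintype.card V →
      (Fintype.card W : ℝ) ≤ 1 / 2 * Fintype.card V * H.edgeConnectivity +
        ((G.minVal : ℝ) - H.edgeConnectivity) →
      (G.boxProd H).scrambleNumber = (G.boxProd H).gonality ∧
        (G.boxProd H).gonality = 2 * Fintype.card W) ∧
    (H.edgeConnectivity = H.gonality →
      (Fintype.card V : ℝ) ≤ 2 * Fintype.card W / H.edgeConnectivity →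
      H.edgeConnectivity ≤ G.minVal →
      (G.boxProd H).scrambleNumber = (G.boxProd H).gonality ∧
        (G.boxProd H).gonality = Fintype.card V * H.edgeConnectivity) := by
  have : Nonempty V := SimpleGraph.Connected.nonempty hG
  have : Nonempty W := SimpleGraph.Connected.nonempty hH
  have hle := (G.boxProd H).scrambleNumber_le_gonality
  constructor
  · intro hgon hlam hquot hδ
    have hup := G.gonality_boxProd_le_left H
    rw [hgon] at hup
    have hpos : (0 : ℝ) < H.edgeConnectivity := by exact_mod_cast Nat.pos_of_ne_zero hlam
    rw [div_le_iff₀ hpos] at hquot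
    have hlow : 2 * Fintype.card W ≤ (G.boxProd H).scrambleNumber := by
      refine G.le_scrambleNumber_boxProd H hκ le_rfl ?_ ?_
      · rify
        linarith
      · rify
        linarith
    omega
  · intro hgon hquot hδ
    have hup := G.gonality_boxProd_le_right H
    rw [← hgon] at hup
    have hpos : (0 : ℝ) < H.edgeConnectivity := by
      rw [hgon]
      exact_mod_cast H.gonality_pos
    rw [le_div_iff₀ hpos] at hquot
    have hlow : Fintype.card V * H.edgeConnectivity ≤ (G.boxProd H).scrambleNumber := by
      refine G.le_scrambleNumber_boxProd H hκ (by exact_mod_cast hquot) le_rfl ?_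
      push_cast
      omega
    omega
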